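/- Let $R$ be a commutative ring, $n\ge 0$, and $w\in S_n$. Let $s_i$ be the transposition of $i$ and $i+1$, and for a polynomial $f$ in $x_1,\dots,x_n$ let $$\overline{\partial}_i f=\frac{x_{i+1}f-x_i\,(s_i\cdot f)}{x_{i+1}-x_i},$$ where $s_i$ exchanges $x_i$ and $x_{i+1}$ (this is again a polynomial). The Grothendieck polynomials $\mathcal G_w(\mathbf x)\in R[x_1,\dots,x_n]$ are obtained from $\mathcal G_{w_0}(\mathbf x)=\prod_{i=1}^n(1-x_i)^{n-i}$, where $w_0$ is the longest permutation, through the recurrence $\mathcal G_{ws_i}=\overline{\partial}_i\mathcal G_w$ whenever $\mathrm{length}(ws_i)<\mathrm{length}(w)$. The double Grothendieck polynomials $\mathcal G_w(\mathbf x,\mathbf y)\in R[y_1,\dots,y_n][x_1,\dots,x_n]$ are obtained through the same recurrence (with $\overline{\partial}_i$ acting on the $x$ variables) from $\mathcal G_{w_0}(\mathbf x,\mathbf y)=\prod_{i+j\le n}(1-x_iy_j)$. Let $Q=Q_{n\times n}$ be the square word in $S_{2n}$, whose letters are indexed by the cells $(i,j)$ of the $n\times n$ grid: the letter at $(i,j)$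 is $s_{i+j-1}$, and the cells are read row by row from top to bottom, each row from right to left. Subwords of $Q$ are regarded as sets of cells. Regard $w$ as an element of $S_{2n}$ that fixes $n+1,\dots,2n$. The subword complex $\Delta(Q,w)$ consists of the subwords $Q\smallsetminus P$ such that some subword of $P$ is a reduced word for $w$; its facets are its inclusion-maximal elements. The Demazure product $\delta(P)\in S_{2n}$ of a subword $P$ is the result of starting with the identity and, for each letter $\sigma$ of $P$ in turn, replacing the current $\pi$ by $\pi\sigma$ if $\mathrm{length}(\pi\sigma)>\mathrm{length}(\pi)$ and keeping $\pi$ otherwise. For a facet $Q\smallsetminus D$, let $\mathrm{abs}(D)$ be the set of all cells $p\notin D$ such that $T=D\cup\{p\}$ satisfies $\delta(T)=\delta(D)$ and the unique cell $q\in D$ with $\delta(T\smallsetminus q)=\delta(D)$ precedes $p$ in the reading order. Then the polynomials $\mathcal G_w(\mathbf x,\mathbf y)$ and $\mathcal G_w(\mathbf x)$ are well defined (the recurrence yields exactly one polynomial of each kind for $w$), and $$\mathcal G_w(\mathbf x,\mathbf y)=\sum_{\text{facets } Q\smallsetminus D}\ \prod_{(i,j)\in D}(1-x_iy_j)\prod_{(i,j)\in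 \mathrm{abs}(D)}x_iy_j,$$ $$\mathcal G_w(\mathbf x)=\sum_{\text{facets } Q\smallsetminus D}\ \prod_{(i,j)\in D}(1-x_i)\prod_{(i,j)\in \mathrm{abs}(D)}x_i,$$ where both sums are over the facets of $\Delta(Q_{n\times n},w)$. -/

import Mathlib

open scoped BigOperators

noncomputable section

namespace SubwordComplex

/-! ### Words, subwords and subword complexes

`s : ι → W` is the family of simple reflections of the group `W`.  A word is a family
`Q : α → ι` of letters, indexed by a finite linearly ordered type `α` of positions; a subword is
a finite set of positions. -/

section Words

variable {W ι α : Type*} [Group W] (s : ι → W)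

/-- The ordered product of a list of simple reflections. -/
def wordProd (ω : List ι) : W := (ω.map s).prod

/-- The length of a group element: the least number of letters of a word with that product. -/
def length (π : W) : ℕ := sInf {k | ∃ ω : List ι, ω.length = k ∧ wordProd s ω = π}

/-- The list `ω` is a reduced decomposition of `π`. -/
def IsReducedWord (ω : List ι) (π : W) : Prop := wordProd s ω = π ∧ ω.length = length s π

open Classical in
/-- Right multiplication by a simple reflection in the basis of the Demazure algebra. -/
def demazureStep (π : W) (i : ι) : W :=
  if length s π < length s (π * s i) then π * s i else π

/-- The Demazure product of a list of simple reflections. -/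
def demazureProd (ω : List ι) : W := ω.foldl (demazureStep s) 1

variable [LinearOrder α] (Q : α → ι)

/-- The letters of the subword `P` of `Q`, in order. -/
def letters (P : Finset α) : List ι := P.sort.map Q

/-- The subword `P` of `Q` represents `π`. -/
def Represents (P : Finset α) (π : W) : Prop := IsReducedWord s (letters Q P) π

/-- The subword `P` of `Q` contains `π`. -/
def Contains (P : Finset α) (π : W) : Prop := ∃ P' ⊆ P, Represents s Q P' π

/-- The Demazure product `δ(P)` of the subword `P` of `Q`. -/
def delta (P : Finset α) : W := demazureProd s (letters Q P)

variable [Fintype α]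

/-- The subword complex `Δ(Q, π)`: the subwords whose complements contain `π`.  The empty
subword is allowed as a face. -/
def complex (π : W) : Set (Finset α) := {F | Contains s Q Fᶜ π}

open Classical in
/-- The facets (inclusion-maximal faces) of the subword complex `Δ(Q, π)`. -/
def facets (π : W) : Finset (Finset α) :=
  Finset.univ.filter fun F => Maximal (fun F' => F' ∈ complex s Q π) F

open Classical in
/-- The set `abs(D)` of absorbable letters of `Q`: those letters `p` outside of the reduced
subword `D` such that `T = D ∪ {p}` satisfies `δ(T) = δ(D)`, and such that the (then unique)
`q ∈ D` with `δ(T ∖ q) = δ(D)` comes before `p`. -/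
def absorbable (D : Finset α) : Finset α :=
  Finset.univ.filter fun p => p ∉ D ∧ delta s Q (insert p D) = delta s Q D ∧
    ∃ q ∈ D, delta s Q ((insert p D).erase q) = delta s Q D ∧ q < p

end Words

/-! ### Symmetric groups and the square word -/

/-- The adjacent transposition of `Fin n` which switches `i` and `i + 1`. -/
def adj (n : ℕ) (i : Fin (n - 1)) : Equiv.Perm (Fin n) :=
  Equiv.swap ⟨i, by omega⟩ ⟨i + 1, by omega⟩

/-- The cells `(i, j)` of the `n × n` grid, in reading order: rows from top to bottom, and each
row from right to left. -/
abbrev Cell (n : ℕ) : Type := Fin n ×ₗ (Fin n)ᵒᵈ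

/-- The row of a cell. -/
def Cell.row {n : ℕ} (p : Cell n) : Fin n := (ofLex p).1

/-- The column of a cell. -/
def Cell.col {n : ℕ} (p : Cell n) : Fin n := OrderDual.ofDual (ofLex p).2

/-- The square word `Q_{n × n}` in `S_{2n}`: with rows, columns and simple reflections all
numbered from `0`, the cell `(i, j)` carries the reflection number `i + j`. -/
def squareWord (n : ℕ) (p : Cell n) : Fin (2 * n - 1) :=
  ⟨p.row + p.col, by have := p.row.2; have := p.col.2; omega⟩

/-- The inclusion of `S_n` in `S_{2n}`, fixing the last `n` points. -/
def embed {n : ℕ} (w : Equiv.Perm (Fin n)) : Equiv.Perm (Fin (2 * n)) :=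
  w.viaEmbedding (Fin.castLEEmb (by omega : n ≤ 2 * n))

/-- The facets of the square subword complex `Δ(Q_{n × n}, w)`. -/
def squareFacets {n : ℕ} (w : Equiv.Perm (Fin n)) : Finset (Finset (Cell n)) :=
  facets (adj (2 * n)) (squareWord n) (embed w)

/-- The absorbable cells of a subword `D` of the square word. -/
def squareAbs {n : ℕ} (D : Finset (Cell n)) : Finset (Cell n) :=
  absorbable (adj (2 * n)) (squareWord n) D

/-! ### Demazure operators and Grothendieck polynomials -/

open MvPolynomial

section Groth

variable {n : ℕ} {R : Type*} [CommRing R]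

theorem isRegular_X_sub_X {σ : Type*} {a b : σ} (hab : a ≠ b) :
    IsRegular (X b - X a : MvPolynomial σ R) := by
  classical
  let φ : MvPolynomial σ R →ₐ[R] MvPolynomial σ R :=
    aeval fun k => if k = b then X b + X a else X k
  let ψ : MvPolynomial σ R →ₐ[R] MvPolynomial σ R :=
    aeval fun k => if k = b then X b - X a else X k
  have hψφ : ψ.comp φ = AlgHom.id R _ := by
    ext k : 1
    by_cases hk : k = b <;> simp [φ, ψ, hk, hab]
  have hinj : Function.Injective φ := fun f g h => by
    have := congrArg ψ h
    rwa [← AlgHom.comp_apply, ← AlgHom.comp_apply, hψφ] at this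
  have hφ : φ (X b - X a) = X b := by simp [φ, hab]
  refine (isLeftRegular_iff_isRegular).1 fun f g h => hinj ?_
  have := congrArg φ h
  simp only [map_mul, hφ] at this
  exact isRegular_X.left this

/-- The quotient that defines the Demazure operator exists and is unique. -/
theorem existsUnique_demazure (i : Fin (n - 1)) (f : MvPolynomial (Fin n) R) :
    ∃! g : MvPolynomial (Fin n) R,
      (X ⟨i + 1, by omega⟩ - X ⟨i, by omega⟩) * g =
        X ⟨i + 1, by omega⟩ * f - X ⟨i, by omega⟩ * rename (adj n i) f := by
  set a : Fin n := ⟨i, by omega⟩ with ha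
  set b : Fin n := ⟨i + 1, by omega⟩ with hb
  have hab : a ≠ b := by simp [ha, hb]
  have hadj : adj n i = Equiv.swap a b := rfl
  let I : Ideal (MvPolynomial (Fin n) R) := Ideal.span {X b - X a}
  have hX : Ideal.Quotient.mk I (X b) = Ideal.Quotient.mk I (X a) :=
    Ideal.Quotient.eq.2 (Ideal.mem_span_singleton_self _)
  have hs : (Ideal.Quotient.mkₐ R I).comp (rename (adj n i)) = Ideal.Quotient.mkₐ R I := by
    ext k : 1
    simp only [AlgHom.comp_apply, rename_X, Ideal.Quotient.mkₐ_eq_mk, hadj, Equiv.swap_apply_def]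
    split_ifs with h1 h2
    · rw [h1, hX]
    · rw [h2, hX]
    · rfl
  have hf : Ideal.Quotient.mk I (rename (adj n i) f) = Ideal.Quotient.mk I f :=
    DFunLike.congr_fun hs f
  have hmem : X b * f - X a * rename (adj n i) f ∈ I := by
    rw [← Ideal.Quotient.eq_zero_iff_mem, map_sub, map_mul, map_mul, hf, hX, sub_self]
  obtain ⟨g, hg⟩ := Ideal.mem_span_singleton.1 hmem
  exact ⟨g, hg.symm, fun g' hg' => (isRegular_X_sub_X hab).left (hg'.trans hg)⟩

/-- The Demazure operator: `(x_{i+1} f - x_i (s_i • f)) / (x_{i+1} - x_i)`. -/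
def demazure (i : Fin (n - 1)) (f : MvPolynomial (Fin n) R) : MvPolynomial (Fin n) R :=
  (existsUnique_demazure i f).choose

theorem demazure_spec (i : Fin (n - 1)) (f : MvPolynomial (Fin n) R) :
    (X ⟨i + 1, by omega⟩ - X ⟨i, by omega⟩) * demazure i f =
      X ⟨i + 1, by omega⟩ * f - X ⟨i, by omega⟩ * rename (adj n i) f :=
  (existsUnique_demazure i f).choose_spec.1

/-- `IsObtained top w G` says that the polynomial `G` is obtained for the permutation `w` by the
recurrence `G_{w s_i} = demazure i G_w`, whenever `length (w s_i) < length w`, from the polynomial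
`top` for the longest permutation `w₀`. -/
inductive IsObtained (top : MvPolynomial (Fin n) R) :
    Equiv.Perm (Fin n) → MvPolynomial (Fin n) R → Prop
  | top : IsObtained top Fin.revPerm top
  | step (w : Equiv.Perm (Fin n)) (G : MvPolynomial (Fin n) R) (i : Fin (n - 1)) :
      IsObtained top w G → length (adj n) (w * adj n i) < length (adj n) w →
      IsObtained top (w * adj n i) (demazure i G)

end Groth

/-- `G` is a Grothendieck polynomial `G_w(x)`.  The top one is `∏ (1 - x_i)^{n-i}`, with `i`
numbered from `1`. -/
def IsGrothendieck (n : ℕ) (R : Type*) [CommRing R] (w : Equiv.Perm (Fin n))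
    (G : MvPolynomial (Fin n) R) : Prop :=
  IsObtained (∏ i : Fin n, (1 - X i) ^ (n - (i + 1 : ℕ))) w G

/-- Polynomials in `x_1, …, x_n` over the polynomial ring `R[y_1, …, y_n]`. -/
abbrev PolyXY (n : ℕ) (R : Type*) [CommRing R] : Type _ :=
  MvPolynomial (Fin n) (MvPolynomial (Fin n) R)

/-- The variable `x_i`. -/
def x {n : ℕ} {R : Type*} [CommRing R] (i : Fin n) : PolyXY n R := X i

/-- The variable `y_j`. -/
def y {n : ℕ} {R : Type*} [CommRing R] (j : Fin n) : PolyXY n R := C (X j)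

/-- `G` is a double Grothendieck polynomial `G_w(x, y)`.  The top one is the product of
`1 - x_i y_j` over all `i + j ≤ n`, with `i` and `j` numbered from `1`; the Demazure operators act
on the variables `x`. -/
def IsDoubleGrothendieck (n : ℕ) (R : Type*) [CommRing R] (w : Equiv.Perm (Fin n))
    (G : PolyXY n R) : Prop :=
  IsObtained (∏ p : Fin n × Fin n with (p.1 + 1 : ℕ) + (p.2 + 1 : ℕ) ≤ n, (1 - x p.1 * y p.2)) w G

end SubwordComplex

end

/-!
Both formulas follow from one about the sums `facetSum y w` over the facets of the square subword
complex, with arbitrary scalars `y_j`: these sums satisfy the recurrence of the Grothendieck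
polynomials (`demazure_facetSum`) and have the right value at the longest permutation
(`facetSum_revPerm`).  Double Grothendieck polynomials are the case in which the `y_j` are
variables, and Grothendieck polynomials the case `y_j = 1`.

*The recurrence.*  The facets of `Δ(Q, w)` are the complements of the reduced subwords `D` for `w`
(`mem_facets_iff`).  For an initial segment `S` of `Q`, consider the sum over the reduced subwords
`D ⊆ S` for `w`, with weight `b_p = 1 - x_i y_j` for the cells `p = (i, j)` of `D` and `1 - b_p` for
the absorbable cells in `S`, as a function of `w`.  Appending a letter `a` to `S` changes this
function by the operator `1 - b_a v`, where `v` is, up to sign, the generator of the `0`-Hecke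
algebra for the letter at `a` (`reducedSum_insert`).  Two facts are behind this: by the exchange
condition, a letter appended to a reduced `D` is absorbable exactly when it is a descent of the
Demazure product (`mem_absorbable_iff_isDescent`), and appending a letter to `D` that keeps it
reduced does not affect the earlier absorbable letters (`mem_absorbable_insert_iff`).  So the
function for the whole of `Q` is obtained by applying, for each row, a product of such operators,
in the manner of Fomin and Kirillov.  The Yang-Baxter equation exchanges the parameters of two
adjacent rows at the cost of a factor `x_i - (x_i - x_{i+1}) v_i` (`rowProd_mul_rowProd`), which
comes out at the other side with index `i + n`, where it has no influence on the values on `S_n`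
(`squareSum_swap`).  Evaluated at a permutation with descent `i`, the resulting identity is the
recurrence (`squareSum_recurrence`).

*The longest permutation.*  Reduced subwords for elements of `S_n` lie in the staircase
`i + j ≤ n`, which has as many cells as the longest permutation has inversions, so that the
staircase is the only candidate and nothing is absorbable (`facetSum_revPerm_eq_zero_or`).  It does
represent the longest permutation, since otherwise the recurrence would lead from zero to the sum
for the identity, which is `1`.
-/

noncomputable section

namespace SubwordComplex

open Equiv

/-! ### Lengths and descents in the symmetric group -/

section Perm

variable {N : ℕ}

theorem adj_mul_self (i : Fin (N - 1)) : adj N i * adj N i = 1 :=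
  swap_mul_self _ _

theorem mul_adj_mul_adj (π : Perm (Fin N)) (i : Fin (N - 1)) :
    π * adj N i * adj N i = π := by
  rw [mul_assoc, adj_mul_self, mul_one]

/-- The permutation `π` has a descent at `i`: its values at `i` and `i + 1` are out of order. -/
def IsDescent (π : Perm (Fin N)) (i : Fin (N - 1)) : Prop :=
  π ⟨i + 1, by omega⟩ < π ⟨i, by omega⟩

theorem not_isDescent_iff {π : Perm (Fin N)} {i : Fin (N - 1)} :
    ¬ IsDescent π i ↔ π ⟨i, by omega⟩ < π ⟨i + 1, by omega⟩ := by
  have h : π ⟨i, by omega⟩ ≠ π ⟨i + 1, by omega⟩ := fun h => by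
    simpa using congrArg Fin.val (π.injective h)
  exact ⟨fun h' => lt_of_le_of_ne (not_lt.1 h') h, fun h' => not_lt.2 h'.le⟩

theorem isDescent_mul_adj_iff {π : Perm (Fin N)} {i : Fin (N - 1)} :
    IsDescent (π * adj N i) i ↔ ¬ IsDescent π i := by
  rw [not_isDescent_iff]
  simp [IsDescent, adj]

theorem not_isDescent_one (i : Fin (N - 1)) : ¬ IsDescent (1 : Perm (Fin N)) i :=
  not_isDescent_iff.2 (by simp [Fin.lt_def])

/-- The inversions of a permutation. -/
def inversions (π : Perm (Fin N)) : Finset (Fin N × Fin N) :=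
  Finset.univ.filter fun p => p.1 < p.2 ∧ π p.2 < π p.1

theorem mem_inversions {π : Perm (Fin N)} {a b : Fin N} :
    (a, b) ∈ inversions π ↔ a < b ∧ π b < π a := by
  simp [inversions]

theorem inversions_mul_adj {π : Perm (Fin N)} {i : Fin (N - 1)} (h : ¬ IsDescent π i) :
    inversions (π * adj N i) = insert (⟨i, by omega⟩, ⟨i + 1, by omega⟩)
      ((inversions π).map ((adj N i).prodCongr (adj N i)).toEmbedding) := by
  rw [not_isDescent_iff] at h
  ext ⟨a, b⟩
  rw [Finset.mem_insert, Finset.mem_map_equiv]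
  simp only [prodCongr_symm, prodCongr_apply, Prod.map_apply, adj, symm_swap, mem_inversions,
    Perm.mul_apply, Prod.mk.injEq]
  by_cases hab : a = ⟨i, by omega⟩ ∧ b = ⟨i + 1, by omega⟩
  · obtain ⟨rfl, rfl⟩ := hab
    simpa using h
  · rw [or_iff_right hab]
    -- Except for the pair `i`, `i + 1`, the transposition preserves the order of any two points.
    by_cases hba : a = ⟨i + 1, by omega⟩ ∧ b = ⟨i, by omega⟩
    · obtain ⟨rfl, rfl⟩ := hba
      simpa using h.le
    · refine and_congr_left fun _ => ?_
      simp only [swap_apply_def]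
      simp only [Fin.ext_iff] at hab hba
      split_ifs <;> simp only [Fin.ext_iff, Fin.lt_def] at * <;> omega

theorem card_inversions_mul_adj {π : Perm (Fin N)} {i : Fin (N - 1)} (h : ¬ IsDescent π i) :
    (inversions (π * adj N i)).card = (inversions π).card + 1 := by
  rw [inversions_mul_adj h, Finset.card_insert_of_notMem, Finset.card_map]
  rw [Finset.mem_map_equiv]
  simp [mem_inversions, adj]

theorem eq_one_of_forall_not_isDescent {π : Perm (Fin N)} (h : ∀ i, ¬ IsDescent π i) :
    π = 1 := by
  have hm : StrictMono π := by
    cases N with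
    | zero => exact fun a => a.elim0
    | succ N => exact Fin.strictMono_iff_lt_succ.2 fun i => not_isDescent_iff.1 (h i)
  ext a
  rw [show (π : Fin N → Fin N) = id from hm.eq_id]
  rfl

theorem eq_revPerm_of_forall_isDescent {π : Perm (Fin N)} (h : ∀ i, IsDescent π i) :
    π = Fin.revPerm := by
  have : Fin.revPerm * π = 1 := eq_one_of_forall_not_isDescent fun i =>
    not_isDescent_iff.2 (Fin.rev_lt_rev.2 (h i))
  rw [← mul_eq_one_iff_inv_eq.1 this]
  rfl

theorem card_inversions_wordProd_le (ω : List (Fin (N - 1))) :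
    (inversions (wordProd (adj N) ω)).card ≤ ω.length := by
  induction ω using List.reverseRecOn with
  | nil => simp [wordProd, inversions, Finset.filter_eq_empty_iff]; intro a b h; exact h.le
  | append_singleton ω i ih =>
    have hp : wordProd (adj N) (ω ++ [i]) = wordProd (adj N) ω * adj N i := by
      simp [wordProd]
    rw [hp, List.length_append, List.length_singleton]
    by_cases h : IsDescent (wordProd (adj N) ω) i
    · have h1 := card_inversions_mul_adj (fun h' => isDescent_mul_adj_iff.1 h' h)
      rw [mul_adj_mul_adj] at h1
      omega
    · rw [card_inversions_mul_adj h]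
      omega

/-- Sorting: a permutation is a product of as many simple reflections as it has inversions. -/
theorem exists_wordProd_eq (π : Perm (Fin N)) :
    ∃ ω : List (Fin (N - 1)), ω.length = (inversions π).card ∧ wordProd (adj N) ω = π := by
  induction hk : (inversions π).card generalizing π with
  | zero =>
    refine ⟨[], rfl, (eq_one_of_forall_not_isDescent fun i hi => ?_).symm⟩
    have h1 := card_inversions_mul_adj (fun h' => isDescent_mul_adj_iff.1 h' hi)
    rw [mul_adj_mul_adj] at h1
    omega
  | succ k ih =>
    have : ∃ i, IsDescent π i := by
      by_contra! h
      have h1 := eq_one_of_forall_not_isDescent h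
      have h2 := card_inversions_wordProd_le (N := N) []
      simp only [wordProd, List.map_nil, List.prod_nil, List.length_nil, ← h1] at h2
      omega
    obtain ⟨i, hi⟩ := this
    have h1 := card_inversions_mul_adj (fun h' => isDescent_mul_adj_iff.1 h' hi)
    rw [mul_adj_mul_adj] at h1
    obtain ⟨ω, hω, hp⟩ := ih (π * adj N i) (by omega)
    refine ⟨ω ++ [i], by simp [hω], ?_⟩
    rw [← mul_adj_mul_adj π i, ← hp]
    simp [wordProd]

theorem length_eq_card_inversions (π : Perm (Fin N)) :
    length (adj N) π = (inversions π).card := by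
  obtain ⟨ω, hω⟩ := exists_wordProd_eq π
  refine le_antisymm (Nat.sInf_le ⟨ω, hω⟩) ?_
  refine le_csInf ⟨_, ω, hω⟩ ?_
  rintro k ⟨ω', rfl, rfl⟩
  exact card_inversions_wordProd_le ω'

theorem length_mul_adj_of_not_isDescent {π : Perm (Fin N)} {i : Fin (N - 1)}
    (h : ¬ IsDescent π i) : length (adj N) (π * adj N i) = length (adj N) π + 1 := by
  rw [length_eq_card_inversions, length_eq_card_inversions, card_inversions_mul_adj h]

theorem length_mul_adj_of_isDescent {π : Perm (Fin N)} {i : Fin (N - 1)}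
    (h : IsDescent π i) : length (adj N) (π * adj N i) + 1 = length (adj N) π := by
  have h1 := length_mul_adj_of_not_isDescent (fun h' => isDescent_mul_adj_iff.1 h' h)
  rw [mul_adj_mul_adj] at h1
  exact h1.symm

theorem length_adj_one : length (adj N) 1 = 0 :=
  Nat.le_zero.1 (Nat.sInf_le ⟨[], rfl, rfl⟩)

theorem demazureStep_of_isDescent {π : Perm (Fin N)} {i : Fin (N - 1)} (h : IsDescent π i) :
    demazureStep (adj N) π i = π := by
  have := length_mul_adj_of_isDescent h
  exact if_neg (by omega)

theorem demazureStep_of_not_isDescent {π : Perm (Fin N)} {i : Fin (N - 1)}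
    (h : ¬ IsDescent π i) : demazureStep (adj N) π i = π * adj N i := by
  have := length_mul_adj_of_not_isDescent h
  exact if_pos (by omega)

theorem isDescent_demazureStep (π : Perm (Fin N)) (i : Fin (N - 1)) :
    IsDescent (demazureStep (adj N) π i) i := by
  by_cases h : IsDescent π i
  · rwa [demazureStep_of_isDescent h]
  · rwa [demazureStep_of_not_isDescent h, isDescent_mul_adj_iff]

theorem length_demazureStep_le (π : Perm (Fin N)) (i : Fin (N - 1)) :
    length (adj N) (demazureStep (adj N) π i) ≤ length (adj N) π + 1 := by
  by_cases h : IsDescent π i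
  · rw [demazureStep_of_isDescent h]
    omega
  · rw [demazureStep_of_not_isDescent h, length_mul_adj_of_not_isDescent h]

/-- The two elements that a step of the Demazure product can come from. -/
theorem eq_or_eq_of_demazureStep_eq {u π : Perm (Fin N)} {i : Fin (N - 1)}
    (h : demazureStep (adj N) u i = π) : u = π ∨ u = π * adj N i := by
  by_cases hu : IsDescent u i
  · exact Or.inl (by rw [← h, demazureStep_of_isDescent hu])
  · exact Or.inr (by rw [← h, demazureStep_of_not_isDescent hu, mul_adj_mul_adj])

/-- The one place where left multiplication by a simple reflection `s` creates a descent at `i` is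
an element `π` with `s π = π s_i`. -/
theorem adj_mul_eq_mul_adj {π : Perm (Fin N)} {i j : Fin (N - 1)} (h : ¬ IsDescent π i)
    (h' : IsDescent (adj N j * π) i) : adj N j * π = π * adj N i := by
  rw [not_isDescent_iff] at h
  set a : Fin N := ⟨i, by omega⟩ with ha
  set b : Fin N := ⟨i + 1, by omega⟩ with hb
  have h'' : adj N j (π b) < adj N j (π a) := h'
  have key : π a = ⟨j, by omega⟩ ∧ π b = ⟨j + 1, by omega⟩ := by
    simp only [adj, swap_apply_def] at h''
    simp only [Fin.ext_iff, Fin.lt_def] at *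
    split_ifs at h'' <;> simp_all <;> omega
  rw [adj, adj, ← key.1, ← key.2]
  exact (mul_swap_eq_swap_mul π a b).symm

end Perm

/-! ### Subwords: products, Demazure products and facets -/

section Subwords

variable {α : Type*} [LinearOrder α]

theorem sort_union_of_lt {S T : Finset α} (h : ∀ a ∈ S, ∀ b ∈ T, a < b) :
    (S ∪ T).sort = S.sort ++ T.sort := by
  induction S using Finset.induction_on_min with
  | empty => simp
  | insert a S ha ih =>
    have hT : ∀ b ∈ T, a < b := h a (Finset.mem_insert_self a S)
    rw [Finset.insert_union, Finset.sort_insert, Finset.sort_insert,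
      ih fun c hc => h c (Finset.mem_insert_of_mem hc), List.cons_append]
    · exact fun b hb => (ha b hb).le
    · exact fun h' => (ha a h').false
    · intro b hb
      rcases Finset.mem_union.1 hb with hb | hb
      exacts [(ha b hb).le, (hT b hb).le]
    · intro hb
      rcases Finset.mem_union.1 hb with hb | hb
      exacts [(ha a hb).false, (hT a hb).false]

section Group

variable {W ι : Type*} [Group W] (s : ι → W) (Q : α → ι)

theorem length_letters (P : Finset α) : (letters Q P).length = P.card := by
  simp [letters]

theorem letters_union_of_lt {S T : Finset α} (h : ∀ a ∈ S, ∀ b ∈ T, a < b) :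
    letters Q (S ∪ T) = letters Q S ++ letters Q T := by
  rw [letters, sort_union_of_lt h, List.map_append]
  rfl

theorem letters_insert_of_lt {a : α} {S : Finset α} (h : ∀ x ∈ S, x < a) :
    letters Q (insert a S) = letters Q S ++ [Q a] := by
  rw [Finset.insert_eq, Finset.union_comm, letters_union_of_lt Q (by simpa using h)]
  simp [letters]

/-- The group product of a subword. -/
def subwordProd (P : Finset α) : W := wordProd s (letters Q P)

theorem subwordProd_empty : subwordProd s Q ∅ = 1 := by
  simp [subwordProd, wordProd, letters]

theorem subwordProd_singleton (a : α) : subwordProd s Q {a} = s (Q a) := by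
  simp [subwordProd, wordProd, letters]

theorem subwordProd_union_of_lt {S T : Finset α} (h : ∀ a ∈ S, ∀ b ∈ T, a < b) :
    subwordProd s Q (S ∪ T) = subwordProd s Q S * subwordProd s Q T := by
  simp [subwordProd, wordProd, letters_union_of_lt Q h]

theorem subwordProd_insert_of_lt {a : α} {S : Finset α} (h : ∀ x ∈ S, x < a) :
    subwordProd s Q (insert a S) = subwordProd s Q S * s (Q a) := by
  simp [subwordProd, wordProd, letters_insert_of_lt Q h]

theorem subwordProd_insert_of_gt {a : α} {S : Finset α} (h : ∀ x ∈ S, a < x) :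
    subwordProd s Q (insert a S) = s (Q a) * subwordProd s Q S := by
  rw [Finset.insert_eq, subwordProd_union_of_lt s Q (by simpa using h), subwordProd_singleton]

theorem delta_empty : delta s Q ∅ = 1 := by
  simp [delta, demazureProd, letters]

theorem delta_insert_of_lt {a : α} {S : Finset α} (h : ∀ x ∈ S, x < a) :
    delta s Q (insert a S) = demazureStep s (delta s Q S) (Q a) := by
  simp [delta, demazureProd, letters_insert_of_lt Q h]

theorem represents_iff_subwordProd {P : Finset α} {π : W} :
    Represents s Q P π ↔ subwordProd s Q P = π ∧ P.card = length s π := by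
  rw [Represents, IsReducedWord, length_letters]
  rfl

/-- The facets are the complements of the reduced subwords, since these all have the same size. -/
theorem mem_facets_iff [Fintype α] {π : W} {F : Finset α} :
    F ∈ facets s Q π ↔ Represents s Q Fᶜ π := by
  have hcard : ∀ {P}, Represents s Q P π → P.card = length s π := fun h =>
    ((represents_iff_subwordProd s Q).1 h).2
  classical
  rw [facets, Finset.mem_filter, and_iff_right (Finset.mem_univ F)]
  constructor
  · rintro ⟨⟨P, hP, hr⟩, hmax⟩
    have h1 : F ≤ Pᶜ := Finset.subset_compl_comm.1 hP
    have h2 : Pᶜ ≤ F := hmax ⟨P, (compl_compl P).ge, hr⟩ h1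
    rwa [le_antisymm h1 h2, compl_compl]
  · intro hr
    refine ⟨⟨Fᶜ, le_rfl, hr⟩, ?_⟩
    rintro F' ⟨P, hP, hr'⟩ hF
    have h1 : P ⊆ Fᶜ := hP.trans (Finset.compl_subset_compl.2 hF)
    have h2 : P = Fᶜ := Finset.eq_of_subset_of_card_le h1 (by rw [hcard hr, hcard hr'])
    rw [h2] at hP
    exact Finset.compl_subset_compl.1 hP

/-- Inserting a letter at `p` multiplies the product of a subword on the right by a reflection
that depends only on the letters after `p`.  Hence, if removing `q < p` and inserting `p` does not
change the product, then inserting `p` has the same effect as removing `q`. -/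
theorem subwordProd_insert_eq_erase (hs : ∀ i, s i * s i = 1) {D : Finset α} {p q : α}
    (hp : p ∉ D) (hqp : q < p)
    (h : subwordProd s Q ((insert p D).erase q) = subwordProd s Q D) :
    subwordProd s Q (insert p D) = subwordProd s Q (D.erase q) := by
  have key : ∀ E : Finset α, p ∉ E → subwordProd s Q (insert p E) = subwordProd s Q E *
      ((subwordProd s Q (E.filter (p < ·)))⁻¹ * s (Q p) *
        subwordProd s Q (E.filter (p < ·))) := by
    intro E hE
    have hlt : ∀ a ∈ E.filter (· < p), ∀ b ∈ E.filter (p < ·), a < b := fun a ha b hb =>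
      (Finset.mem_filter.1 ha).2.trans (Finset.mem_filter.1 hb).2
    have h1 : E = E.filter (· < p) ∪ E.filter (p < ·) := by
      rw [← Finset.filter_or, Finset.filter_true_of_mem]
      exact fun a ha => lt_or_gt_of_ne fun h => hE (h ▸ ha)
    have h2 : insert p E = E.filter (· < p) ∪ insert p (E.filter (p < ·)) := by
      rw [Finset.union_insert, ← h1]
    rw [h2, subwordProd_union_of_lt, subwordProd_insert_of_gt]
    · conv_rhs => rw [h1]
      rw [subwordProd_union_of_lt s Q (by simpa [← h1] using hlt), ← h1]
      group
    · exact fun x hx => (Finset.mem_filter.1 hx).2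
    · intro a ha b hb
      rcases Finset.mem_insert.1 hb with rfl | hb
      exacts [(Finset.mem_filter.1 ha).2, hlt a ha b hb]
  have hfil : (D.erase q).filter (p < ·) = D.filter (p < ·) := by
    rw [Finset.filter_erase, Finset.erase_eq_of_notMem]
    exact fun hq => hqp.asymm (Finset.mem_filter.1 hq).2
  rw [Finset.erase_insert_of_ne hqp.ne',
    key _ fun h' => hp (Finset.mem_of_mem_erase h'), hfil] at h
  rw [key D hp, ← h]
  set u := subwordProd s Q (D.filter (p < ·))
  calc subwordProd s Q (D.erase q) * (u⁻¹ * s (Q p) * u) * (u⁻¹ * s (Q p) * u)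
      = subwordProd s Q (D.erase q) * u⁻¹ * (s (Q p) * s (Q p)) * u := by group
    _ = subwordProd s Q (D.erase q) := by rw [hs]; group

end Group

variable {N : ℕ} (Q : α → Fin (N - 1))

theorem length_delta_le (P : Finset α) : length (adj N) (delta (adj N) Q P) ≤ P.card := by
  induction P using Finset.induction_on_max with
  | empty => rw [delta_empty, length_adj_one]; rfl
  | insert a P ha ih =>
    rw [delta_insert_of_lt _ _ ha, Finset.card_insert_of_notMem fun h => (ha a h).false]
    exact (length_demazureStep_le _ _).trans (Nat.add_le_add_right ih 1)

theorem length_subwordProd_le (P : Finset α) :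
    length (adj N) (subwordProd (adj N) Q P) ≤ P.card :=
  Nat.sInf_le ⟨letters Q P, length_letters Q P, rfl⟩

/-- A subword is a reduced word for `π` if and only if its Demazure product is `π` and it has as many
letters as the length of `π`. -/
theorem represents_iff {P : Finset α} {π : Perm (Fin N)} :
    Represents (adj N) Q P π ↔
      delta (adj N) Q P = π ∧ P.card = length (adj N) π := by
  rw [represents_iff_subwordProd]
  -- Unless the two products agree, both are shorter than the subword.
  suffices h : subwordProd (adj N) Q P = delta (adj N) Q P ∨
      P.card ≠ length (adj N) (subwordProd (adj N) Q P) ∧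
      P.card ≠ length (adj N) (delta (adj N) Q P) by
    rcases h with h | h
    · rw [h]
    · constructor <;> rintro ⟨rfl, h'⟩
      exacts [absurd h' h.1, absurd h' h.2]
  induction P using Finset.induction_on_max with
  | empty => exact Or.inl ((subwordProd_empty _ _).trans (delta_empty _ _).symm)
  | insert a P ha ih =>
    rw [delta_insert_of_lt _ _ ha, subwordProd_insert_of_lt _ _ ha,
      Finset.card_insert_of_notMem fun h => (ha a h).false]
    have h1 := length_delta_le Q P
    have h2 := length_subwordProd_le Q P
    rcases ih with ih | ih
    · rw [ih] at h2 ⊢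
      by_cases hd : IsDescent (delta (adj N) Q P) (Q a)
      · have := length_mul_adj_of_isDescent hd
        rw [demazureStep_of_isDescent hd]
        omega
      · exact Or.inl (demazureStep_of_not_isDescent hd).symm
    · refine Or.inr ⟨?_, ?_⟩
      · by_cases hd : IsDescent (subwordProd (adj N) Q P) (Q a)
        · have := length_mul_adj_of_isDescent hd
          omega
        · rw [length_mul_adj_of_not_isDescent hd]
          omega
      · have := length_demazureStep_le (delta (adj N) Q P) (Q a)
        omega

/-- The exchange condition: if the product of a subword has a descent at `i`, then multiplying by
`s_i` amounts to removing a letter. -/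
theorem exists_subwordProd_erase {D : Finset α} {i : Fin (N - 1)}
    (h : IsDescent (subwordProd (adj N) Q D) i) :
    ∃ q ∈ D, subwordProd (adj N) Q (D.erase q) = subwordProd (adj N) Q D * adj N i := by
  induction D using Finset.induction_on_min with
  | empty => exact absurd (subwordProd_empty (adj N) Q ▸ h) (not_isDescent_one i)
  | insert a D ha ih =>
    have haD : a ∉ D := fun h => (ha a h).false
    rw [subwordProd_insert_of_gt _ _ ha] at h ⊢
    -- The letter to be removed is the one at which the products of the suffixes acquire the descent.
    by_cases hd : IsDescent (subwordProd (adj N) Q D) i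
    · obtain ⟨q, hq, hprod⟩ := ih hd
      refine ⟨q, Finset.mem_insert_of_mem hq, ?_⟩
      rw [Finset.erase_insert_of_ne (ha q hq).ne, subwordProd_insert_of_gt, hprod, mul_assoc]
      exact fun x hx => ha x (Finset.mem_of_mem_erase hx)
    · refine ⟨a, Finset.mem_insert_self a D, ?_⟩
      rw [Finset.erase_insert haD, adj_mul_eq_mul_adj hd h, mul_adj_mul_adj]

/-! ### Absorbable letters -/

variable [Fintype α]

theorem mem_absorbable {D : Finset α} {p : α} :
    p ∈ absorbable (adj N) Q D ↔ p ∉ D ∧ delta (adj N) Q (insert p D) = delta (adj N) Q D ∧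
      ∃ q ∈ D, delta (adj N) Q ((insert p D).erase q) = delta (adj N) Q D ∧ q < p := by
  simp [absorbable]

/-- A letter after a reduced subword is absorbable precisely at the descents of the Demazure
product; the exchange condition provides the letter that it can replace. -/
theorem mem_absorbable_iff_isDescent {D : Finset α} {a : α} (ha : ∀ x ∈ D, x < a)
    (hD : D.card = length (adj N) (delta (adj N) Q D)) :
    a ∈ absorbable (adj N) Q D ↔ IsDescent (delta (adj N) Q D) (Q a) := by
  have haD : a ∉ D := fun h => (ha a h).false
  rw [mem_absorbable, delta_insert_of_lt _ _ ha]
  constructor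
  · rintro ⟨-, h, -⟩
    exact h ▸ isDescent_demazureStep _ _
  · intro h
    refine ⟨haD, demazureStep_of_isDescent h, ?_⟩
    have hprod := ((represents_iff_subwordProd _ _).1 ((represents_iff Q).2 ⟨rfl, hD⟩)).1
    obtain ⟨q, hq, hq'⟩ := exists_subwordProd_erase Q (hprod.symm ▸ h)
    have h1 : delta (adj N) Q (D.erase q) = delta (adj N) Q D * adj N (Q a) := by
      refine ((represents_iff Q).1 ((represents_iff_subwordProd _ _).2 ⟨hq'.trans ?_, ?_⟩)).1
      · rw [hprod]
      · have := length_mul_adj_of_isDescent h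
        rw [Finset.card_erase_of_mem hq]
        omega
    refine ⟨q, hq, ?_, ha q hq⟩
    rw [Finset.erase_insert_of_ne (ha q hq).ne', delta_insert_of_lt _ _
      fun x hx => ha x (Finset.mem_of_mem_erase hx), h1, demazureStep_of_not_isDescent,
      mul_adj_mul_adj]
    exact fun h' => isDescent_mul_adj_iff.1 h' h

/-- Appending a letter to a subword, so that it stays reduced, does not change which of the
earlier letters are absorbable. -/
theorem mem_absorbable_insert_iff {D : Finset α} {a p : α} (ha : ∀ x ∈ D, x < a)
    (hD : D.card = length (adj N) (delta (adj N) Q D))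
    (h : ¬ IsDescent (delta (adj N) Q D) (Q a)) (hpa : p < a) :
    p ∈ absorbable (adj N) Q (insert a D) ↔ p ∈ absorbable (adj N) Q D := by
  have haD : a ∉ D := fun h => (ha a h).false
  have hpD : ∀ x ∈ insert p D, x < a := by simpa [hpa] using ha
  have hpE : ∀ q, ∀ x ∈ (insert p D).erase q, x < a :=
    fun q x hx => hpD x (Finset.mem_of_mem_erase hx)
  set w := delta (adj N) Q D with hw
  have hstep := demazureStep_of_not_isDescent h
  have hlen := length_mul_adj_of_not_isDescent h
  rw [mem_absorbable, mem_absorbable, Finset.insert_comm, delta_insert_of_lt _ _ ha,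
    delta_insert_of_lt _ _ hpD, Finset.mem_insert, not_or, ← hw]
  constructor
  · rintro ⟨⟨-, hp⟩, hins, q, hq, hrem, hqp⟩
    have hqa : q ≠ a := (hqp.trans hpa).ne
    have hqD : q ∈ D := (Finset.mem_insert.1 hq).resolve_left hqa
    rw [Finset.erase_insert_of_ne hqa.symm, delta_insert_of_lt _ _ (hpE q), hstep] at hrem
    rw [hstep] at hins
    have hcard : ((insert p D).erase q).card = D.card := by
      rw [Finset.card_erase_of_mem (Finset.mem_insert_of_mem hqD),
        Finset.card_insert_of_notMem hp, Nat.add_sub_cancel]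
    have hEw : delta (adj N) Q ((insert p D).erase q) = w := by
      rcases eq_or_eq_of_demazureStep_eq hrem with h' | h'
      · have := length_delta_le Q ((insert p D).erase q)
        rw [h', hcard] at this
        omega
      · rwa [mul_adj_mul_adj] at h'
    refine ⟨hp, ?_, q, hqD, hEw, hqp⟩
    rcases eq_or_eq_of_demazureStep_eq hins with h' | h'
    · -- The subword `D ∪ {p}` would be reduced, but its product is that of `D ∖ {q}`.
      exfalso
      have hcard' : (insert p D).card = D.card + 1 := Finset.card_insert_of_notMem hp
      have e1 := ((represents_iff_subwordProd _ _).1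
        ((represents_iff Q).2 ⟨h', by omega⟩)).1
      have e2 := ((represents_iff_subwordProd _ _).1
        ((represents_iff Q).2 ⟨hEw, by omega⟩)).1
      have e3 := ((represents_iff_subwordProd _ _).1
        ((represents_iff Q).2 ⟨hw.symm, by omega⟩)).1
      have e4 := subwordProd_insert_eq_erase (adj N) Q adj_mul_self hp hqp (e2.trans e3.symm)
      have e5 := length_subwordProd_le Q (D.erase q)
      rw [← e4, e1, hlen, Finset.card_erase_of_mem hqD] at e5
      omega
    · rwa [mul_adj_mul_adj] at h'
  · rintro ⟨hp, hins, q, hq, hrem, hqp⟩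
    refine ⟨⟨hpa.ne, hp⟩, by rw [hins], q, Finset.mem_insert_of_mem hq, ?_, hqp⟩
    rw [Finset.erase_insert_of_ne (hqp.trans hpa).ne', delta_insert_of_lt _ _ (hpE q), hrem]

end Subwords

/-! ### The action of the `0`-Hecke algebra on functions -/

section Hecke

variable {N : ℕ} {A : Type*} [CommRing A]

open Classical in
/-- The negative of the `k`-th generator of the `0`-Hecke algebra, acting on functions on `S_N`, as
coefficients of the basis elements, by right multiplication; it is an idempotent.  For the sake of
the relations, `k` is any natural number, and the operators for which there is no simple reflection
are zero. -/
def heckeOp (N : ℕ) (A : Type*) [CommRing A] (k : ℕ) : Module.End A (Perm (Fin N) → A) :=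
  if h : k < N - 1 then
    { toFun := fun f π => if IsDescent π ⟨k, h⟩ then f π - f (π * adj N ⟨k, h⟩) else 0
      map_add' := fun f g => by
        ext π
        simp only [Pi.add_apply]
        split_ifs <;> ring
      map_smul' := fun c f => by
        ext π
        simp only [Pi.smul_apply, smul_eq_mul, RingHom.id_apply]
        split_ifs <;> ring }
  else 0

theorem heckeOp_apply_of_isDescent {i : Fin (N - 1)} {π : Perm (Fin N)} (h : IsDescent π i)
    (f : Perm (Fin N) → A) : heckeOp N A i f π = f π - f (π * adj N i) := by
  simp [heckeOp, h]

theorem heckeOp_apply_of_not_isDescent {i : Fin (N - 1)} {π : Perm (Fin N)}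
    (h : ¬ IsDescent π i) (f : Perm (Fin N) → A) : heckeOp N A i f π = 0 := by
  simp [heckeOp, h]

theorem heckeOp_of_le {k : ℕ} (h : N - 1 ≤ k) : heckeOp N A k = 0 :=
  dif_neg (by omega)

theorem heckeOp_apply {k : ℕ} (h : k + 1 < N) (f : Perm (Fin N) → A) (π : Perm (Fin N)) :
    heckeOp N A k f π = if π ⟨k + 1, h⟩ < π ⟨k, by omega⟩ then
      f π - f (π * swap ⟨k, by omega⟩ ⟨k + 1, h⟩) else 0 := by
  have hk : k < N - 1 := by omega
  by_cases hd : IsDescent π ⟨k, hk⟩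
  · exact (heckeOp_apply_of_isDescent hd f).trans (if_pos hd).symm
  · exact (heckeOp_apply_of_not_isDescent hd f).trans (if_neg hd).symm

theorem heckeOp_mul_self (k : ℕ) : heckeOp N A k * heckeOp N A k = heckeOp N A k := by
  by_cases hk : N - 1 ≤ k
  · simp [heckeOp_of_le hk]
  · refine LinearMap.ext fun f => funext fun π => ?_
    have hk' : k + 1 < N := by omega
    simp only [Module.End.mul_apply, heckeOp_apply hk', Perm.mul_apply, swap_apply_left,
      swap_apply_right]
    by_cases h : π ⟨k + 1, hk'⟩ < π ⟨k, by omega⟩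
    · simp [h, h.not_gt]
    · simp [h]

theorem heckeOp_commute {k l : ℕ} (hkl : k + 2 ≤ l) :
    Commute (heckeOp N A k) (heckeOp N A l) := by
  by_cases hl : N - 1 ≤ l
  · rw [heckeOp_of_le hl]
    exact Commute.zero_right _
  · have h1 : k + 1 < N := by omega
    have h2 : l + 1 < N := by omega
    refine LinearMap.ext fun f => funext fun π => ?_
    simp only [Module.End.mul_apply, heckeOp_apply h1, heckeOp_apply h2, Perm.mul_apply]
    have e : swap (⟨k, by omega⟩ : Fin N) ⟨k + 1, h1⟩ * swap ⟨l, by omega⟩ ⟨l + 1, h2⟩ =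
        swap ⟨l, by omega⟩ ⟨l + 1, h2⟩ * swap ⟨k, by omega⟩ ⟨k + 1, h1⟩ :=
      (Perm.disjoint_swap_swap (by simp [Fin.ext_iff]; omega)).commute
    have s1 : swap (⟨k, by omega⟩ : Fin N) ⟨k + 1, h1⟩ ⟨l, by omega⟩ = ⟨l, by omega⟩ :=
      swap_apply_of_ne_of_ne (by simp; omega) (by simp; omega)
    have s2 : swap (⟨k, by omega⟩ : Fin N) ⟨k + 1, h1⟩ ⟨l + 1, h2⟩ = ⟨l + 1, h2⟩ :=
      swap_apply_of_ne_of_ne (by simp; omega) (by simp; omega)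
    have s3 : swap (⟨l, by omega⟩ : Fin N) ⟨l + 1, h2⟩ ⟨k, by omega⟩ = ⟨k, by omega⟩ :=
      swap_apply_of_ne_of_ne (by simp; omega) (by simp; omega)
    have s4 : swap (⟨l, by omega⟩ : Fin N) ⟨l + 1, h2⟩ ⟨k + 1, h1⟩ = ⟨k + 1, h1⟩ :=
      swap_apply_of_ne_of_ne (by simp; omega) (by simp; omega)
    simp only [s1, s2, s3, s4, mul_assoc, e]
    split_ifs <;> ring

theorem heckeOp_braid (k : ℕ) : heckeOp N A k * heckeOp N A (k + 1) * heckeOp N A k =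
    heckeOp N A (k + 1) * heckeOp N A k * heckeOp N A (k + 1) := by
  by_cases hk : N - 1 ≤ k + 1
  · simp [heckeOp_of_le hk]
  · have h1 : k + 1 < N := by omega
    have h2 : k + 1 + 1 < N := by omega
    refine LinearMap.ext fun f => funext fun π => ?_
    simp only [Module.End.mul_apply, heckeOp_apply h1, heckeOp_apply h2, Perm.mul_apply]
    set p : Fin N := ⟨k, by omega⟩
    set q : Fin N := ⟨k + 1, h1⟩
    set r : Fin N := ⟨k + 1 + 1, h2⟩
    have hpq : p ≠ q := by simp [p, q]
    have hpr : p ≠ r := by simp [p, r]; omega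
    have hqr : q ≠ r := by simp [q, r]
    have s1 : swap p q r = r := swap_apply_of_ne_of_ne hpr.symm hqr.symm
    have s2 : swap q r p = p := swap_apply_of_ne_of_ne hpq hpr
    have e : π * swap p q * swap q r * swap p q = π * swap q r * swap p q * swap q r := by
      have e1 := swap_mul_swap_mul_swap hqr.symm hpr.symm
      rw [swap_comm q p, swap_comm r q, swap_comm p r,
        ← swap_mul_swap_mul_swap hpq hpr] at e1
      simp only [mul_assoc] at e1 ⊢
      rw [e1]
    simp only [swap_apply_left, swap_apply_right, s1, s2, e]
    -- Both sides depend only on the relative order of the three values of `π`.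
    have hpq' := π.injective.ne hpq
    have hpr' := π.injective.ne hpr
    have hqr' := π.injective.ne hqr
    rcases lt_or_gt_of_ne hpq' with a | a <;> rcases lt_or_gt_of_ne hqr' with b | b <;>
      rcases lt_or_gt_of_ne hpr' with c | c <;>
      first
      | (exfalso; order)
      | (simp only [a, b, c, a.not_gt, b.not_gt, c.not_gt, if_true, if_false]; try ring)

end Hecke

/-! ### The Yang-Baxter equation -/

section YangBaxter

variable {A : Type*} [CommRing A] {H : Type*} [Ring H] [Algebra A H]

/-- The Yang-Baxter equation for idempotents that satisfy the braid relation. -/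
theorem yangBaxter {v w : H} (hv : v * v = v) (hw : w * w = w) (hb : v * w * v = w * v * w)
    {a b c d : A} (h : b * c = d + a * c - a * d) :
    (c • 1 - d • v) * (1 - b • w) * (1 - a • v) =
      (1 - a • w) * (1 - b • v) * (c • 1 - d • w) := by
  have hb' : v * (w * v) = w * (v * w) := by rw [← mul_assoc, hb, mul_assoc]
  simp only [sub_mul, mul_sub, smul_mul_assoc, mul_smul_comm, one_mul, mul_one, mul_assoc, hv, hw,
    hb']
  match_scalars <;> first | ring1 | linear_combination h | linear_combination -h

variable (v : ℕ → H) (y : ℕ → A)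

/-- The product of the factors `1 - (1 - x y_j) v_{i+j}` for `j < m`, which is the contribution of
(a part of) row `i` of the grid.  When the product acts on functions, the factor with the largest
`j` acts first, since rows are read from right to left. -/
def rowProd (i : ℕ) (x : A) : ℕ → H
  | 0 => 1
  | m + 1 => rowProd i x m * (1 - (1 - x * y m) • v (i + m))

theorem commute_rowProd {u : H} {i m : ℕ} (x : A) (h : ∀ j < m, Commute u (v (i + j))) :
    Commute u (rowProd v y i x m) := by
  induction m with
  | zero => exact Commute.one_right u
  | succ m ih =>
    exact (ih fun j hj => h j (by omega)).mul_right
      ((Commute.one_right u).sub_right ((h m (by omega)).smul_right _))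

/-- Exchanging the parameters of two consecutive rows, by repeated use of the Yang-Baxter
equation. -/
theorem rowProd_mul_rowProd (hv : ∀ k, v k * v k = v k)
    (hc : ∀ k l, k + 2 ≤ l → Commute (v k) (v l))
    (hb : ∀ k, v k * v (k + 1) * v k = v (k + 1) * v k * v (k + 1)) (i m : ℕ) (x x' : A) :
    (x • 1 - (x - x') • v i) * rowProd v y (i + 1) x' m * rowProd v y i x m =
      rowProd v y (i + 1) x m * rowProd v y i x' m * (x • 1 - (x - x') • v (i + m)) := by
  induction m with
  | zero => simp [rowProd]
  | succ m ih =>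
    have hcomm : ∀ (t b : A), (1 - b • v (i + 1 + m)) * rowProd v y i t m =
        rowProd v y i t m * (1 - b • v (i + 1 + m)) := fun t b =>
      (commute_rowProd v y t fun j hj => ((Commute.one_left _).sub_left
        ((hc (i + j) (i + 1 + m) (by omega)).symm.smul_left b))).eq
    have hyb := yangBaxter (hv (i + m)) (hv (i + m + 1)) (hb (i + m))
      (a := 1 - x * y m) (b := 1 - x' * y m) (c := x) (d := x - x') (by ring)
    rw [show i + m + 1 = i + 1 + m by omega] at hyb
    simp only [rowProd]
    rw [show i + (m + 1) = i + 1 + m by omega]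
    set ρ := x • (1 : H) - (x - x') • v i
    set ρ' := x • (1 : H) - (x - x') • v (i + m)
    calc ρ * (rowProd v y (i + 1) x' m * (1 - (1 - x' * y m) • v (i + 1 + m))) *
          (rowProd v y i x m * (1 - (1 - x * y m) • v (i + m)))
        = ρ * rowProd v y (i + 1) x' m * ((1 - (1 - x' * y m) • v (i + 1 + m)) *
          rowProd v y i x m) * (1 - (1 - x * y m) • v (i + m)) := by simp only [mul_assoc]
      _ = (ρ * rowProd v y (i + 1) x' m * rowProd v y i x m) *
          (1 - (1 - x' * y m) • v (i + 1 + m)) * (1 - (1 - x * y m) • v (i + m)) := by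
        rw [hcomm]; simp only [mul_assoc]
      _ = rowProd v y (i + 1) x m * rowProd v y i x' m *
          (ρ' * (1 - (1 - x' * y m) • v (i + 1 + m)) * (1 - (1 - x * y m) • v (i + m))) := by
        rw [ih]; simp only [mul_assoc]
      _ = rowProd v y (i + 1) x m * (rowProd v y i x' m * (1 - (1 - x * y m) • v (i + 1 + m))) *
          (1 - (1 - x' * y m) • v (i + m)) * (x • 1 - (x - x') • v (i + 1 + m)) := by
        rw [hyb]; simp only [mul_assoc]
      _ = _ := by rw [← hcomm]; simp only [mul_assoc]

end YangBaxter

/-! ### The sum over reduced subwords -/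

section ReducedSum

variable {α : Type*} [LinearOrder α] {N : ℕ} (Q : α → Fin (N - 1))

theorem represents_insert_iff {D : Finset α} {a : α} (ha : ∀ x ∈ D, x < a) {π : Perm (Fin N)} :
    Represents (adj N) Q (insert a D) π ↔
      IsDescent π (Q a) ∧ Represents (adj N) Q D (π * adj N (Q a)) := by
  rw [represents_iff, represents_iff, delta_insert_of_lt _ _ ha,
    Finset.card_insert_of_notMem fun h => (ha a h).false]
  constructor
  · rintro ⟨h, hcard⟩
    have hd : IsDescent π (Q a) := h ▸ isDescent_demazureStep _ _
    have hlen := length_mul_adj_of_isDescent hd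
    refine ⟨hd, (eq_or_eq_of_demazureStep_eq h).resolve_left fun h' => ?_, by omega⟩
    have := length_delta_le Q D
    rw [h'] at this
    omega
  · rintro ⟨hd, h, hcard⟩
    have hlen := length_mul_adj_of_isDescent hd
    rw [h, demazureStep_of_not_isDescent (fun h' => isDescent_mul_adj_iff.1 h' hd),
      mul_adj_mul_adj]
    exact ⟨rfl, by omega⟩

variable [Fintype α] {A : Type*} [CommRing A] (b : α → A)

open Classical in
/-- The sum over the reduced subwords `D` of `S` for `π` of the weights `b p` of the letters of
`D`, times the weights `1 - b p` of the absorbable letters in `S`. -/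
def reducedSum (S : Finset α) (π : Perm (Fin N)) : A :=
  ∑ D ∈ S.powerset with Represents (adj N) Q D π,
    (∏ p ∈ D, b p) * ∏ p ∈ absorbable (adj N) Q D ∩ S, (1 - b p)

theorem reducedSum_congr {b b' : α → A} {S : Finset α} (h : ∀ p ∈ S, b p = b' p) :
    reducedSum Q b S = reducedSum Q b' S := by
  classical
  funext π
  refine Finset.sum_congr rfl fun D hD => ?_
  have hDS := Finset.mem_powerset.1 (Finset.mem_filter.1 hD).1
  congr 1
  · exact Finset.prod_congr rfl fun p hp => h p (hDS hp)
  · exact Finset.prod_congr rfl fun p hp => by rw [h p (Finset.mem_inter.1 hp).2]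

theorem map_reducedSum {B : Type*} [CommRing B] (φ : A →+* B) (S : Finset α)
    (π : Perm (Fin N)) : φ (reducedSum Q b S π) = reducedSum Q (fun p => φ (b p)) S π := by
  simp [reducedSum, map_sum, map_mul, map_prod]

/-- Appending a letter acts on the sum over reduced subwords by an element of the `0`-Hecke
algebra. -/
theorem reducedSum_insert {S : Finset α} {a : α} (ha : ∀ x ∈ S, x < a) :
    reducedSum Q b (insert a S) =
      (1 - b a • heckeOp N A (Q a)) (reducedSum Q b S) := by
  classical
  have haS : a ∉ S := fun h => (ha a h).false
  funext π
  simp only [LinearMap.sub_apply, LinearMap.smul_apply, Module.End.one_apply, Pi.sub_apply,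
    Pi.smul_apply, smul_eq_mul]
  -- The subwords without `a`: this letter is absorbable exactly if `π` has a descent there.
  have old : ∀ D ∈ S.powerset, (if Represents (adj N) Q D π then
      (∏ p ∈ D, b p) * ∏ p ∈ absorbable (adj N) Q D ∩ insert a S, (1 - b p) else 0) =
      (if IsDescent π (Q a) then 1 - b a else 1) * if Represents (adj N) Q D π then
      (∏ p ∈ D, b p) * ∏ p ∈ absorbable (adj N) Q D ∩ S, (1 - b p) else 0 := by
    intro D hD
    have hDa : ∀ x ∈ D, x < a := fun x hx => ha x (Finset.mem_powerset.1 hD hx)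
    split_ifs with h hd hd
    · obtain ⟨rfl, hcard⟩ := (represents_iff Q).1 h
      rw [Finset.inter_insert_of_mem ((mem_absorbable_iff_isDescent Q hDa hcard).2 hd),
        Finset.prod_insert fun h => haS (Finset.mem_inter.1 h).2]
      ring
    · obtain ⟨rfl, hcard⟩ := (represents_iff Q).1 h
      rw [Finset.inter_insert_of_notMem
        fun h => hd ((mem_absorbable_iff_isDescent Q hDa hcard).1 h), one_mul]
    · ring
    · ring
  -- The subwords with `a`, which are reduced words for `π` only if `π` has a descent there.
  have new : ∀ D ∈ S.powerset, (if Represents (adj N) Q (insert a D) π then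
      (∏ p ∈ insert a D, b p) *
        ∏ p ∈ absorbable (adj N) Q (insert a D) ∩ insert a S, (1 - b p) else 0) =
      (if IsDescent π (Q a) then b a else 0) * if Represents (adj N) Q D (π * adj N (Q a)) then
      (∏ p ∈ D, b p) * ∏ p ∈ absorbable (adj N) Q D ∩ S, (1 - b p) else 0 := by
    intro D hD
    have hDa : ∀ x ∈ D, x < a := fun x hx => ha x (Finset.mem_powerset.1 hD hx)
    rw [represents_insert_iff Q hDa]
    by_cases hd : IsDescent π (Q a)
    · by_cases h : Represents (adj N) Q D (π * adj N (Q a))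
      · obtain ⟨h1, h2⟩ := (represents_iff Q).1 h
        have habs : absorbable (adj N) Q (insert a D) ∩ insert a S =
            absorbable (adj N) Q D ∩ S := by
          ext p
          rw [Finset.mem_inter, Finset.mem_inter, Finset.mem_insert]
          by_cases hp : p = a
          · subst hp
            simp [mem_absorbable, haS]
          · rw [or_iff_right hp]
            refine and_congr_left fun hpS =>
              mem_absorbable_insert_iff Q hDa (h1.symm ▸ h2) ?_ (ha p hpS)
            rw [h1]
            exact fun h' => isDescent_mul_adj_iff.1 h' hd
        rw [habs, Finset.prod_insert fun h => (hDa a h).false]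
        simp only [hd, h, and_self, if_true]
        ring
      · simp [h]
    · simp [hd]
  rw [reducedSum, Finset.sum_filter, Finset.sum_powerset_insert haS, Finset.sum_congr rfl old,
    Finset.sum_congr rfl new, ← Finset.mul_sum, ← Finset.mul_sum, ← Finset.sum_filter,
    ← Finset.sum_filter, ← reducedSum, ← reducedSum]
  by_cases hd : IsDescent π (Q a)
  · rw [heckeOp_apply_of_isDescent hd, if_pos hd, if_pos hd]
    ring
  · rw [heckeOp_apply_of_not_isDescent hd, if_neg hd, if_neg hd]
    ring

end ReducedSum

/-! ### Rows of the square word -/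

section Square

variable {n : ℕ}

theorem Cell.lt_iff {p q : Cell n} :
    p < q ↔ p.row < q.row ∨ p.row = q.row ∧ q.col < p.col :=
  Prod.Lex.lt_iff

theorem Cell.ext_iff {p q : Cell n} : p = q ↔ p.row = q.row ∧ p.col = q.col :=
  ⟨fun h => h ▸ ⟨rfl, rfl⟩, fun h => ofLex_inj.1 (Prod.ext h.1 h.2)⟩

/-- The cells of the rows before row `i`, and those of row `i` from column `m` on: an initial
segment of the reading order. -/
def cellsBefore (n i m : ℕ) : Finset (Cell n) :=
  Finset.univ.filter fun p => (p.row : ℕ) < i ∨ (p.row : ℕ) = i ∧ m ≤ p.col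

theorem mem_cellsBefore {i m : ℕ} {p : Cell n} :
    p ∈ cellsBefore n i m ↔ (p.row : ℕ) < i ∨ (p.row : ℕ) = i ∧ m ≤ p.col := by
  simp [cellsBefore]

theorem cellsBefore_succ (i : ℕ) : cellsBefore n (i + 1) n = cellsBefore n i 0 := by
  ext p
  have := p.col.2
  simp only [mem_cellsBefore]
  omega

theorem cellsBefore_eq_univ : cellsBefore n n n = Finset.univ := by
  ext p
  have := p.row.2
  simp [mem_cellsBefore]

variable {A : Type*} [CommRing A] (x y : ℕ → A)

/-- The sum over reduced subwords of an initial part of the square word, with the weight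
`1 - x_i y_j` at the cell `(i, j)`. -/
def squareSum (n : ℕ) (S : Finset (Cell n)) : Perm (Fin (2 * n)) → A :=
  reducedSum (squareWord n) (fun p => 1 - x p.row * y p.col) S

theorem squareSum_row {i : ℕ} (hi : i < n) {m : ℕ} (hm : m ≤ n) :
    rowProd (heckeOp (2 * n) A) y i (x i) m (squareSum x y n (cellsBefore n i m)) =
      squareSum x y n (cellsBefore n i 0) := by
  induction m with
  | zero => simp [rowProd]
  | succ m ih =>
    rw [← ih (by omega), rowProd, Module.End.mul_apply]
    congr 1
    let a : Cell n := toLex (⟨i, hi⟩, OrderDual.toDual ⟨m, by omega⟩)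
    have har : a.row = ⟨i, hi⟩ := rfl
    have hac : a.col = ⟨m, by omega⟩ := rfl
    have hins : cellsBefore n i m = insert a (cellsBefore n i (m + 1)) := by
      ext p
      rw [Finset.mem_insert, Cell.ext_iff, mem_cellsBefore, mem_cellsBefore, har, hac,
        Fin.ext_iff, Fin.ext_iff]
      simp only
      omega
    have hlt : ∀ p ∈ cellsBefore n i (m + 1), p < a := by
      intro p hp
      rw [mem_cellsBefore] at hp
      rw [Cell.lt_iff, har, hac, Fin.lt_def, Fin.lt_def, Fin.ext_iff]
      simp only
      omega
    rw [hins]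
    exact (reducedSum_insert (squareWord n) (fun p : Cell n => 1 - x p.row * y p.col) hlt).symm

theorem squareSum_succ {i : ℕ} (hi : i < n) :
    squareSum x y n (cellsBefore n (i + 1) n) =
      rowProd (heckeOp (2 * n) A) y i (x i) n (squareSum x y n (cellsBefore n i n)) := by
  rw [cellsBefore_succ, squareSum_row x y hi le_rfl]

/-! ### Functions that vanish on the parabolic subgroup -/

theorem embed_apply_of_lt (w : Perm (Fin n)) {k : ℕ} (hk : k < n) (hk' : k < 2 * n) :
    ((embed w ⟨k, hk'⟩ : Fin (2 * n)) : ℕ) = w ⟨k, hk⟩ :=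
  congrArg Fin.val
    (Perm.viaEmbedding_apply w (Fin.castLEEmb (by omega : n ≤ 2 * n)) ⟨k, hk⟩)

theorem embed_apply_of_le (w : Perm (Fin n)) {k : ℕ} (hk : n ≤ k) (hk' : k < 2 * n) :
    embed w ⟨k, hk'⟩ = ⟨k, hk'⟩ :=
  Perm.viaEmbedding_apply_of_notMem _ _ _ (by
    rintro ⟨j, hj⟩
    have := congrArg Fin.val hj
    simp at this
    omega)

theorem isDescent_embed_iff {w : Perm (Fin n)} {i : Fin (n - 1)} :
    IsDescent (embed w) ⟨i, by omega⟩ ↔ IsDescent w i := by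
  rw [IsDescent, IsDescent, Fin.lt_def, Fin.lt_def, embed_apply_of_lt w, embed_apply_of_lt w]

theorem not_isDescent_embed (w : Perm (Fin n)) {k : Fin (2 * n - 1)} (hk : n ≤ k + 1) :
    ¬ IsDescent (embed w) k := by
  rw [not_isDescent_iff, Fin.lt_def, embed_apply_of_le w hk]
  by_cases h : (k : ℕ) < n
  · rw [embed_apply_of_lt w h]
    simp only
    omega
  · rw [embed_apply_of_le w (by omega)]
    simp

theorem embed_mul_adj (w : Perm (Fin n)) (i : Fin (n - 1)) :
    embed (w * adj n i) = embed w * adj (2 * n) ⟨i, by omega⟩ := by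
  ext k
  rw [Perm.mul_apply]
  obtain ⟨k, hk⟩ := k
  by_cases h : k < n
  · rw [embed_apply_of_lt _ h, Perm.mul_apply]
    have : adj (2 * n) ⟨i, by omega⟩ ⟨k, hk⟩ = ⟨adj n i ⟨k, h⟩, by omega⟩ := by
      simp only [adj, swap_apply_def, Fin.mk.injEq]
      split_ifs <;> rfl
    rw [this, embed_apply_of_lt]
  · rw [embed_apply_of_le _ (by omega)]
    have : adj (2 * n) ⟨i, by omega⟩ ⟨k, hk⟩ = ⟨k, hk⟩ :=
      swap_apply_of_ne_of_ne (by simp; omega) (by simp; omega)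
    rw [this, embed_apply_of_le _ (by omega)]

theorem embed_one : embed (1 : Perm (Fin n)) = 1 :=
  map_one (Perm.viaEmbeddingHom (Fin.castLEEmb (by omega : n ≤ 2 * n)))

/-- The functions on `S_{2n}` that vanish on `S_n`. -/
def vanishing (n : ℕ) (A : Type*) [CommRing A] : Submodule A (Perm (Fin (2 * n)) → A) where
  carrier := {f | ∀ w : Perm (Fin n), f (embed w) = 0}
  add_mem' hf hg w := by simp [hf w, hg w]
  zero_mem' w := rfl
  smul_mem' c f hf w := by simp [hf w]

theorem heckeOp_mem_vanishing_of_le {k : ℕ} (hk : n ≤ k + 1) (f : Perm (Fin (2 * n)) → A) :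
    heckeOp (2 * n) A k f ∈ vanishing n A := by
  intro w
  by_cases h : k < 2 * n - 1
  · exact heckeOp_apply_of_not_isDescent (not_isDescent_embed w (k := ⟨k, h⟩) hk) f
  · rw [heckeOp_of_le (by omega)]
    rfl

theorem heckeOp_mem_vanishing (k : ℕ) {f : Perm (Fin (2 * n)) → A} (hf : f ∈ vanishing n A) :
    heckeOp (2 * n) A k f ∈ vanishing n A := by
  by_cases hk : n ≤ k + 1
  · exact heckeOp_mem_vanishing_of_le hk f
  · intro w
    by_cases hd : IsDescent (embed w) ⟨k, by omega⟩
    · refine (heckeOp_apply_of_isDescent hd f).trans ?_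
      rw [← embed_mul_adj w ⟨k, by omega⟩, hf, hf, sub_zero]
    · exact heckeOp_apply_of_not_isDescent hd f

theorem rowProd_mem_vanishing (i : ℕ) (t : A) (m : ℕ) {f : Perm (Fin (2 * n)) → A}
    (hf : f ∈ vanishing n A) : rowProd (heckeOp (2 * n) A) y i t m f ∈ vanishing n A := by
  induction m generalizing f with
  | zero => exact hf
  | succ m ih =>
    exact ih (sub_mem hf (Submodule.smul_mem _ _ (heckeOp_mem_vanishing _ hf)))

/-- Exchanging `x_i` and `x_{i+1}` in the sum over reduced subwords of the square word.  The
Yang-Baxter equation moves the factor `x_i - (x_i - x_{i+1}) v_i` through the two rows, where it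
becomes a factor at `i + n`, which does not matter on `S_n`. -/
theorem squareSum_swap {x x' : ℕ → A} {i : ℕ} (hi : i + 1 < n) (h1 : x' i = x (i + 1))
    (h2 : x' (i + 1) = x i) (h3 : ∀ k, k ≠ i → k ≠ i + 1 → x' k = x k) :
    (x i • 1 - (x i - x (i + 1)) • heckeOp (2 * n) A i :
        Module.End A (Perm (Fin (2 * n)) → A)) (squareSum x y n Finset.univ) -
      x i • squareSum x' y n Finset.univ ∈ vanishing n A := by
  set v := heckeOp (2 * n) A
  set ρ : Module.End A (Perm (Fin (2 * n)) → A) := x i • 1 - (x i - x (i + 1)) • v i with hρ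
  suffices h : ∀ r, i + 2 + r ≤ n → ρ (squareSum x y n (cellsBefore n (i + 2 + r) n)) -
      x i • squareSum x' y n (cellsBefore n (i + 2 + r) n) ∈ vanishing n A by
    have := h (n - (i + 2)) (by omega)
    rwa [show i + 2 + (n - (i + 2)) = n by omega, cellsBefore_eq_univ] at this
  intro r hr
  induction r with
  | zero =>
    have hyb := rowProd_mul_rowProd v y heckeOp_mul_self
      (fun k l => heckeOp_commute) heckeOp_braid i n (x i) (x (i + 1))
    have hsame : squareSum x' y n (cellsBefore n i n) = squareSum x y n (cellsBefore n i n) := by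
      refine reducedSum_congr _ fun p hp => ?_
      have hp' : (p.row : ℕ) < i := by
        have := p.col.2
        rw [mem_cellsBefore] at hp
        omega
      rw [h3 _ (by omega) (by omega)]
    have e1 : squareSum x y n (cellsBefore n (i + 2) n) =
        rowProd v y (i + 1) (x (i + 1)) n (rowProd v y i (x i) n
          (squareSum x y n (cellsBefore n i n))) := by
      rw [← squareSum_succ x y (by omega), ← squareSum_succ x y (by omega)]
    have e2 : squareSum x' y n (cellsBefore n (i + 2) n) =
        rowProd v y (i + 1) (x i) n (rowProd v y i (x (i + 1)) n
          (squareSum x y n (cellsBefore n i n))) := by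
      rw [← hsame, ← h2, ← h1, ← squareSum_succ x' y (by omega), ← squareSum_succ x' y (by omega)]
    set f := squareSum x y n (cellsBefore n i n)
    have e3 := LinearMap.congr_fun hyb f
    simp only [Module.End.mul_apply] at e3
    rw [add_zero, e1, e2, hρ, e3, ← map_smul, ← map_smul, ← map_sub, ← map_sub]
    refine rowProd_mem_vanishing y _ _ _ (rowProd_mem_vanishing y _ _ _ ?_)
    have e4 : (x i • 1 - (x i - x (i + 1)) • v (i + n) :
        Module.End A (Perm (Fin (2 * n)) → A)) f - x i • f =
        -((x i - x (i + 1)) • v (i + n) f) := by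
      simp
    rw [e4]
    exact neg_mem (Submodule.smul_mem _ _ (heckeOp_mem_vanishing_of_le (by omega) f))
  | succ r ih =>
    have hcomm : Commute ρ (rowProd v y (i + 2 + r) (x (i + 2 + r)) n) :=
      commute_rowProd v y _ fun j _ => ((Commute.one_left _).smul_left _).sub_left
        ((heckeOp_commute (by omega)).smul_left _)
    have e := LinearMap.congr_fun hcomm.eq (squareSum x y n (cellsBefore n (i + 2 + r) n))
    simp only [Module.End.mul_apply] at e
    rw [← add_assoc, squareSum_succ x y (by omega), squareSum_succ x' y (by omega),
      h3 _ (by omega) (by omega), e, ← map_smul, ← map_sub]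
    exact rowProd_mem_vanishing y _ _ _ (ih (by omega))

/-- The recurrence for the sums over reduced subwords, before division by `x_{i+1} - x_i`. -/
theorem squareSum_recurrence {x x' : ℕ → A} {i : Fin (n - 1)} (h1 : x' i = x (i + 1))
    (h2 : x' (i + 1) = x i) (h3 : ∀ k, k ≠ (i : ℕ) → k ≠ i + 1 → x' k = x k)
    {w : Perm (Fin n)} (hw : IsDescent w i) :
    (x (i + 1) - x i) * squareSum x y n Finset.univ (embed (w * adj n i)) =
      x (i + 1) * squareSum x y n Finset.univ (embed w) -
        x i * squareSum x' y n Finset.univ (embed w) := by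
  have h := squareSum_swap y (by omega : (i : ℕ) + 1 < n) h1 h2 h3 w
  have hd := heckeOp_apply_of_isDescent (isDescent_embed_iff.2 hw) (squareSum x y n Finset.univ)
  simp only [LinearMap.sub_apply, LinearMap.smul_apply, Module.End.one_apply, Pi.sub_apply,
    Pi.smul_apply, smul_eq_mul] at h
  simp only at hd
  rw [hd, ← embed_mul_adj] at h
  linear_combination -h

end Square

/-! ### The longest permutation -/

section Top

variable {n : ℕ}

/-- The cells `(i, j)` with `i + j ≤ n`, numbered from `1`. -/
def staircase (n : ℕ) : Finset (Cell n) :=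
  Finset.univ.filter fun p => (p.row : ℕ) + p.col + 1 < n

theorem mem_staircase {p : Cell n} : p ∈ staircase n ↔ (p.row : ℕ) + p.col + 1 < n := by
  simp [staircase]

/-- Letters outside of the staircase create descents that elements of `S_n` do not have. -/
theorem subset_staircase_of_delta_eq {D : Finset (Cell n)} {w : Perm (Fin n)}
    (h : delta (adj (2 * n)) (squareWord n) D = embed w) : D ⊆ staircase n := by
  induction D using Finset.induction_on_max generalizing w with
  | empty => exact Finset.empty_subset _
  | insert a D ha ih =>
    rw [delta_insert_of_lt _ _ ha] at h
    have hlt : (a.row : ℕ) + a.col + 1 < n := by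
      by_contra hle
      exact not_isDescent_embed w (k := squareWord n a) (not_lt.1 hle)
        (h ▸ isDescent_demazureStep _ _)
    refine Finset.insert_subset (mem_staircase.2 hlt) ?_
    rcases eq_or_eq_of_demazureStep_eq h with h' | h'
    · exact ih h'
    · exact ih (h'.trans (embed_mul_adj w ⟨a.row + a.col, by omega⟩).symm)

theorem card_inversions_le_embed (w : Perm (Fin n)) :
    (inversions w).card ≤ (inversions (embed w)).card := by
  refine Finset.card_le_card_of_injOn
    (fun p => (⟨p.1, by omega⟩, ⟨p.2, by omega⟩)) ?_ ?_
  · rintro ⟨a, b⟩ hab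
    obtain ⟨h1, h2⟩ := mem_inversions.1 (Finset.mem_coe.1 hab)
    refine Finset.mem_coe.2 (mem_inversions.2 ⟨h1, ?_⟩)
    rw [Fin.lt_def, embed_apply_of_lt w a.2, embed_apply_of_lt w b.2]
    exact h2
  · rintro ⟨a, b⟩ - ⟨c, d⟩ - h
    simpa [Fin.ext_iff] using h

/-- The number of cells `(i, j)` of the staircase is the number of pairs `i < n - 1 - j`, with
`i` and `j` numbered from `0`. -/
theorem card_staircase_le : (staircase n).card ≤ (inversions (Fin.revPerm (n := n))).card := by
  refine Finset.card_le_card_of_injOn (fun p => (p.row, Fin.rev p.col)) ?_ ?_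
  · intro p hp
    have hp' := mem_staircase.1 (Finset.mem_coe.1 hp)
    have hlt : p.row < Fin.rev p.col := by
      rw [Fin.lt_def, Fin.val_rev]
      omega
    exact Finset.mem_coe.2 (mem_inversions.2 ⟨hlt, Fin.rev_lt_rev.2 hlt⟩)
  · intro p _ q _ h
    exact Cell.ext_iff.2 ⟨(Prod.mk.inj h).1, Fin.rev_injective (Prod.mk.inj h).2⟩

theorem eq_staircase_of_represents {D : Finset (Cell n)}
    (h : Represents (adj (2 * n)) (squareWord n) D (embed Fin.revPerm)) : D = staircase n := by
  obtain ⟨hδ, hcard⟩ := (represents_iff _).1 h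
  refine Finset.eq_of_subset_of_card_le (subset_staircase_of_delta_eq hδ) ?_
  rw [hcard, length_eq_card_inversions]
  exact card_staircase_le.trans (card_inversions_le_embed _)

end Top

/-! ### The recurrence -/

open MvPolynomial

section Recurrence

variable {n : ℕ} {S : Type*} [CommRing S]

theorem length_mul_adj_lt_iff {w : Perm (Fin n)} {i : Fin (n - 1)} :
    length (adj n) (w * adj n i) < length (adj n) w ↔ IsDescent w i := by
  by_cases h : IsDescent w i
  · have := length_mul_adj_of_isDescent h
    exact iff_of_true (by omega) h
  · have := length_mul_adj_of_not_isDescent h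
    exact iff_of_false (by omega) h

/-- Every permutation is reached from the longest one, through ascents. -/
theorem exists_isObtained (top : MvPolynomial (Fin n) S) (w : Perm (Fin n)) :
    ∃ G, IsObtained top w G := by
  induction hk : Fintype.card (Fin n × Fin n) - (inversions w).card using
    Nat.strong_induction_on generalizing w with
  | _ k ih =>
    by_cases h : ∀ i, IsDescent w i
    · rw [eq_revPerm_of_forall_isDescent h]
      exact ⟨top, .top⟩
    · push Not at h
      obtain ⟨i, hi⟩ := h
      have hcard := card_inversions_mul_adj hi
      have hle := Finset.card_le_univ (inversions (w * adj n i))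
      obtain ⟨G, hG⟩ := ih _ (by omega) (w * adj n i) rfl
      have := IsObtained.step _ G i hG
        (length_mul_adj_lt_iff.2 (isDescent_mul_adj_iff.2 hi))
      rw [mul_adj_mul_adj] at this
      exact ⟨_, this⟩

theorem eq_demazure {i : Fin (n - 1)} {f g : MvPolynomial (Fin n) S}
    (h : (X ⟨i + 1, by omega⟩ - X ⟨i, by omega⟩) * g =
      X ⟨i + 1, by omega⟩ * f - X ⟨i, by omega⟩ * rename (adj n i) f) : demazure i f = g :=
  (existsUnique_demazure i f).unique (demazure_spec i f) h

/-- The sum over the facets of the square subword complex, with the weight `1 - x_i y_j` at the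
cell `(i, j)`, where the `y_j` are scalars. -/
def facetSum (y : Fin n → S) (w : Perm (Fin n)) : MvPolynomial (Fin n) S :=
  ∑ F ∈ squareFacets w, (∏ p ∈ Fᶜ, (1 - X p.row * C (y p.col))) *
    ∏ p ∈ squareAbs Fᶜ, X p.row * C (y p.col)

theorem facetSum_eq_reducedSum (y : Fin n → S) (w : Perm (Fin n)) :
    facetSum y w = reducedSum (squareWord n)
      (fun p => 1 - X p.row * C (y p.col)) Finset.univ (embed w) := by
  classical
  refine Finset.sum_bij (fun F _ => Fᶜ) ?_ ?_ ?_ ?_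
  · intro F hF
    exact Finset.mem_filter.2 ⟨by simp, (mem_facets_iff _ _).1 hF⟩
  · exact fun F _ F' _ h => compl_injective h
  · intro D hD
    exact ⟨Dᶜ, (mem_facets_iff _ _).2 (by simpa using hD), compl_compl D⟩
  · intro F _
    rw [Finset.inter_univ]
    simp [squareAbs]

theorem demazure_facetSum (y : Fin n → S) {w : Perm (Fin n)} {i : Fin (n - 1)}
    (hw : IsDescent w i) : demazure i (facetSum y w) = facetSum y (w * adj n i) := by
  refine eq_demazure ?_
  let x : ℕ → MvPolynomial (Fin n) S := fun k => if h : k < n then X ⟨k, h⟩ else 0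
  let x' : ℕ → MvPolynomial (Fin n) S := fun k => rename (adj n i) (x k)
  let y' : ℕ → MvPolynomial (Fin n) S := fun k => if h : k < n then C (y ⟨k, h⟩) else 0
  have hx : ∀ k (h : k < n), x k = X ⟨k, h⟩ := fun k h => dif_pos h
  have hi : (i : ℕ) + 1 < n := by omega
  have hsum : ∀ u, facetSum y u = squareSum x y' n Finset.univ (embed u) := fun u => by
    rw [facetSum_eq_reducedSum]
    simp [squareSum, x, y']
  have hren : rename (adj n i) (facetSum y w) = squareSum x' y' n Finset.univ (embed w) := by
    rw [hsum]
    refine (map_reducedSum _ _ (rename (adj n i) : _ →ₐ[S] _).toRingHom _ _).trans ?_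
    simp [squareSum, x', y']
  have h1 : x' i = x (i + 1) := by
    simp only [x']
    rw [hx i (by omega), hx (i + 1) hi, rename_X, adj, swap_apply_left]
  have h2 : x' (i + 1) = x i := by
    simp only [x']
    rw [hx i (by omega), hx (i + 1) hi, rename_X, adj, swap_apply_right]
  have h3 : ∀ k, k ≠ (i : ℕ) → k ≠ i + 1 → x' k = x k := by
    intro k hk hk'
    simp only [x', x]
    split_ifs with h
    · rw [rename_X, adj, swap_apply_of_ne_of_ne (by simpa using hk) (by simpa using hk')]
    · exact map_zero _
  have key := squareSum_recurrence y' h1 h2 h3 hw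
  rw [hx i (by omega), hx (i + 1) hi, ← hren, ← hsum, ← hsum] at key
  exact key

theorem eq_facetSum_of_isObtained {y : Fin n → S} {w : Perm (Fin n)}
    {G : MvPolynomial (Fin n) S} (h : IsObtained (facetSum y Fin.revPerm) w G) :
    G = facetSum y w := by
  induction h with
  | top => rfl
  | step w G i _ hlt ih => rw [ih, demazure_facetSum y (length_mul_adj_lt_iff.1 hlt)]

theorem eq_zero_of_isObtained_zero {w : Perm (Fin n)} {G : MvPolynomial (Fin n) S}
    (h : IsObtained 0 w G) : G = 0 := by
  induction h with
  | top => rfl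
  | step w G i _ _ ih =>
    rw [ih]
    exact eq_demazure (by simp)

theorem facetSum_one (y : Fin n → S) : facetSum y 1 = 1 := by
  classical
  have h : ∀ D : Finset (Cell n), Represents (adj (2 * n)) (squareWord n) D 1 ↔ D = ∅ := by
    intro D
    rw [represents_iff, length_adj_one, Finset.card_eq_zero]
    exact and_iff_right_of_imp fun h => h ▸ delta_empty _ _
  have habs : absorbable (adj (2 * n)) (squareWord n) ∅ = ∅ := by
    ext p
    simp [mem_absorbable]
  rw [facetSum_eq_reducedSum, embed_one, reducedSum, Finset.sum_filter, Finset.sum_eq_single ∅]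
  · simp [h, habs]
  · intro D _ hD
    rw [if_neg fun h' => hD ((h D).1 h')]
  · simp

theorem facetSum_revPerm_eq_zero_or (y : Fin n → S) : facetSum y Fin.revPerm = 0 ∨
    facetSum y Fin.revPerm = ∏ p ∈ staircase n, (1 - X p.row * C (y p.col)) := by
  classical
  rw [facetSum_eq_reducedSum, reducedSum, Finset.sum_filter,
    Finset.sum_eq_single (staircase n) ?_ (by simp)]
  · split_ifs with h
    · right
      have habs : absorbable (adj (2 * n)) (squareWord n) (staircase n) = ∅ := by
        refine Finset.eq_empty_of_forall_notMem fun p hp => ?_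
        obtain ⟨h1, h2, -⟩ := (mem_absorbable _).1 hp
        rw [((represents_iff _).1 h).1] at h2
        exact h1 (subset_staircase_of_delta_eq h2 (Finset.mem_insert_self _ _))
      simp [habs]
    · exact Or.inl rfl
  · intro D _ hD
    rw [if_neg fun h => hD (eq_staircase_of_represents h)]

/-- That the staircase is a subword for the longest permutation follows from the recurrence:
otherwise it would lead from zero to the sum for the identity, which is `1`. -/
theorem facetSum_revPerm (y : Fin n → S) :
    facetSum y Fin.revPerm = ∏ p ∈ staircase n, (1 - X p.row * C (y p.col)) := by
  rcases facetSum_revPerm_eq_zero_or y with h | h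
  · obtain ⟨G, hG⟩ := exists_isObtained (facetSum y Fin.revPerm) 1
    have h1 := eq_facetSum_of_isObtained hG
    rw [h] at hG
    rw [eq_zero_of_isObtained_zero hG, facetSum_one] at h1
    have := subsingleton_of_zero_eq_one h1
    exact Subsingleton.elim _ _
  · exact h

/-- The form of `facetSum_revPerm` with pairs of indices numbered from `1`. -/
theorem facetSum_revPerm_eq_prod (y : Fin n → S) : facetSum y Fin.revPerm =
    ∏ p : Fin n × Fin n with (p.1 + 1 : ℕ) + (p.2 + 1 : ℕ) ≤ n, (1 - X p.1 * C (y p.2)) := by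
  rw [facetSum_revPerm]
  refine Finset.prod_bij (fun p _ => (p.row, p.col)) ?_ ?_ ?_ fun _ _ => rfl
  · intro p hp
    rw [mem_staircase] at hp
    simp only [Finset.mem_filter, Finset.mem_univ, true_and]
    omega
  · exact fun p _ q _ h => Cell.ext_iff.2 ⟨congrArg Prod.fst h, congrArg Prod.snd h⟩
  · rintro ⟨i, j⟩ h
    simp only [Finset.mem_filter, Finset.mem_univ, true_and] at h
    refine ⟨toLex (i, OrderDual.toDual j), mem_staircase.2 ?_, rfl⟩
    change (i : ℕ) + j + 1 < n
    omega

theorem facetSum_revPerm_one : facetSum (fun _ : Fin n => (1 : S)) Fin.revPerm =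
    ∏ i : Fin n, (1 - X i) ^ (n - (i + 1 : ℕ)) := by
  rw [facetSum_revPerm_eq_prod, Finset.prod_filter, Fintype.prod_prod_type]
  refine Finset.prod_congr rfl fun i _ => ?_
  have hcard : (Finset.univ.filter fun j : Fin n => (i + 1 : ℕ) + (j + 1 : ℕ) ≤ n).card =
      n - (i + 1 : ℕ) := by
    rw [← min_eq_right (Nat.sub_le n (i + 1)), ← Fin.card_filter_val_lt]
    congr 1
    ext j
    simp only [Finset.mem_filter, Finset.mem_univ, true_and]
    omega
  simp only [map_one, mul_one]
  rw [← Finset.prod_filter, Finset.prod_const, hcard]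

theorem existsUnique_isObtained {top : MvPolynomial (Fin n) S} {y : Fin n → S}
    (h : facetSum y Fin.revPerm = top) (w : Perm (Fin n)) :
    (∃! G, IsObtained top w G) ∧ ∀ G, IsObtained top w G → G = facetSum y w := by
  subst h
  obtain ⟨G, hG⟩ := exists_isObtained (facetSum y Fin.revPerm) w
  exact ⟨⟨G, hG, fun G' hG' =>
    (eq_facetSum_of_isObtained hG').trans (eq_facetSum_of_isObtained hG).symm⟩,
    fun G' hG' => eq_facetSum_of_isObtained hG'⟩

end Recurrence

end SubwordComplex

end
open SubwordComplex MvPolynomial in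
theorem mainTheorem6 (R : Type*) [CommRing R] (n : ℕ) (w : Equiv.Perm (Fin n)) :
    ((∃! G : PolyXY n R, IsDoubleGrothendieck n R w G) ∧
      ∀ G : PolyXY n R, IsDoubleGrothendieck n R w G →
        G = ∑ F ∈ squareFacets w,
          (∏ p ∈ Fᶜ, (1 - x p.row * y p.col)) * ∏ p ∈ squareAbs Fᶜ, x p.row * y p.col) ∧
    ((∃! G : MvPolynomial (Fin n) R, IsGrothendieck n R w G) ∧
      ∀ G : MvPolynomial (Fin n) R, IsGrothendieck n R w G →
        G = ∑ F ∈ squareFacets w,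
          (∏ p ∈ Fᶜ, (1 - X p.row)) * ∏ p ∈ squareAbs Fᶜ, X p.row) := by
  refine ⟨existsUnique_isObtained (facetSum_revPerm_eq_prod fun j => X j) w, ?_⟩
  have h := existsUnique_isObtained (facetSum_revPerm_one (n := n) (S := R)) w
  simp only [facetSum, map_one, mul_one] at h
  exact h
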